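/- Let $G$ be a semi-Markovian graph (an acyclic directed graph with additional bidirected edges) on a finite vertex set $\mathbf V$, let $\mathbf X,\mathbf Y\subseteq\mathbf V$ be disjoint and let $W\in\mathbf V$. $\mathrm{An}$ and $\mathrm{De}$ denote the sets of ancestors and descendants of a set in a graph, and $\mathrm{Co}$ the set of vertices connected to it by paths along which edge directions are ignored; all three contain the set itself. For a set $\mathbf A$, $G_{\overline{\mathbf A}}$ is $G$ with all edges having an arrowhead at a vertex of $\mathbf A$ removed (including bidirected edges with an endpoint in $\mathbf A$), and $G[\mathbf A]$ is the induced subgraph. A semi-Markovian causal model with diagram $G$ has finitely many independent background variables, each an argument of at most two structural functions; the observed arguments of $f_V$ are the parents of $V$ in $G$, and $V\leftrightarrow V'$ is in $G$ if and only if $V\neq V'$ share a background variable. The observed variables take values in nonempty countable discrete spaces. $P(\mathbf V)$ is the distribution of the observed variables in the model, and $P_{\mathbf x}(\mathbf y)$ is the probability of $\mathbf Y=\mathbf y$ after the functions of the variables in $\mathbf X$ are replaced by the constants $\mathbf x$. It is identifiable from $P$ in $G$ if there is one functional that computes it from $P(\mathbf V)$, for all $\mathbf x,\mathbf y$, in every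 model with diagram $G$ (and the given value spaces) for which $P(\mathbf v)>0$ for all $\mathbf v$. Assume $G=G[\mathrm{An}(\mathbf Y)_G]$, and put $$\mathbf R=\mathrm{An}(W)_{G_{\overline{\mathbf X}}}\setminus \mathrm{De}(\mathbf X)_G,\qquad \mathbf T=\mathbf R\setminus\mathrm{Co}(\mathbf V\setminus\mathbf R)_{G_{\overline{W}}}.$$ Then $\mathbf T\cap\mathbf X=\emptyset$, and if $\mathbf Y\subseteq \mathrm{De}(\mathbf X)_G$ (in particular if $\mathbf X\ne\emptyset$ and $\mathbf Y$ is a singleton), then $\mathbf T\cap\mathbf Y=\emptyset$. Whenever $\mathbf T\cap\mathbf Y=\emptyset$, the set $\mathbf T$ can be removed from $G$ without changing $P_{\mathbf x}(\mathbf y)$, in the following sense, where $G'=G[\mathbf V\setminus\mathbf T]$: 1. for every semi-Markovian causal model with diagram $G$, observed distribution $P$ and effect $P_{\mathbf x}(\mathbf y)$, there is a semi-Markovian causal model with diagram $G'$ whose observed distribution is the marginal $P'=P(\mathbf V\setminus\mathbf T)$ and whose effect satisfies $P'_{\mathbf x}(\mathbf y)=P_{\mathbf x}(\mathbf y)$ for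 all $\mathbf x,\mathbf y$; 2. a functional $F$ computes the effect of $\mathbf X$ on $\mathbf Y$ from the observed distribution in all models with diagram $G'$ and positive observed distribution if and only if $P\mapsto F(P(\mathbf V\setminus\mathbf T))$ does so in all models with diagram $G$ and positive observed distribution; 3. the effect is identifiable from $P'$ in $G'$ if and only if it is identifiable from $P$ in $G$. -/

import Mathlib

open MeasureTheory
open scoped ENNReal

universe u

/-- A semi-Markovian graph (SMG) on the vertex set `V`: an acyclic directed graph `dir`
(`dir a b` is the edge `a → b`) together with bidirected edges `bi` (`bi.Adj a b` is `a ↔ b`). -/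
structure SMG (V : Type u) where
  dir : V → V → Prop
  bi : SimpleGraph V
  acyclic : ∀ v, ¬ Relation.TransGen dir v v

namespace SMG

variable {V : Type u}

/-- `An(S)_G`: the set `S` together with all its ancestors. -/
def An (G : SMG V) (S : Set V) : Set V :=
  {v | ∃ s ∈ S, Relation.ReflTransGen G.dir v s}

/-- `De(S)_G`: the set `S` together with all its descendants. -/
def De (G : SMG V) (S : Set V) : Set V :=
  {v | ∃ s ∈ S, Relation.ReflTransGen G.dir s v}

/-- The undirected graph obtained by ignoring the directionality of all (directed and bidirected)
edges. -/
def skeleton (G : SMG V) : SimpleGraph V :=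
  SimpleGraph.fromRel fun a b => G.dir a b ∨ G.bi.Adj a b

/-- `Co(S)_G`: all vertices connected to `S` by a path on which directions are ignored,
including `S`. -/
def Co (G : SMG V) (S : Set V) : Set V :=
  {v | ∃ s ∈ S, G.skeleton.Reachable s v}

/-- The graph `G` with all incoming edges of `X` removed; a bidirected edge is incoming at both of
its endpoints. -/
def removeIn (G : SMG V) (X : Set V) : SMG V where
  dir a b := G.dir a b ∧ b ∉ X
  bi :=
    { Adj := fun a b => G.bi.Adj a b ∧ a ∉ X ∧ b ∉ X
      symm := ⟨fun _ _ h => ⟨h.1.symm, h.2.2, h.2.1⟩⟩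
      loopless := ⟨fun _ h => h.1.ne rfl⟩ }
  acyclic v h := G.acyclic v (Relation.TransGen.mono (fun _ _ h => h.1) _ _ h)

/-- The induced subgraph `G[S]`. -/
def induce (G : SMG V) (S : Set V) : SMG S where
  dir a b := G.dir a b
  bi := G.bi.induce S
  acyclic v h := G.acyclic v (Relation.TransGen.lift Subtype.val (fun _ _ h => h) _ _ h)

theorem wellFounded_dir [Finite V] (G : SMG V) : WellFounded G.dir := by
  have : Std.Irrefl (Relation.TransGen G.dir) := ⟨G.acyclic⟩
  exact Subrelation.wf (r := Relation.TransGen G.dir) (fun h => Relation.TransGen.single h)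
    (Finite.wellFounded_of_trans_of_irrefl _)

end SMG

/-- A semi-Markovian causal model with observed variables `v : V` taking values in `Ω v` and with
causal diagram `G`. The background variables are indexed by the finite type `U`, are mutually
independent with laws `law`, and each of them is an argument of at most two of the functions `f`.
The observed arguments of `f v` are the parents of `v` in `G`, its unobserved arguments are the
members of `arg v`, and `a ↔ b` in `G` precisely when `a ≠ b` share a background variable. -/
structure SemiMarkovianModel {V : Type u} (G : SMG V) (Ω : V → Type u)
    [∀ v, MeasurableSpace (Ω v)] where
  U : Type u
  [fintypeU : Fintype U]
  Θ : U → Type u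
  [measurableSpaceΘ : ∀ i, MeasurableSpace (Θ i)]
  law : ∀ i, Measure (Θ i)
  [isProbabilityMeasure_law : ∀ i, IsProbabilityMeasure (law i)]
  arg : V → Set U
  arg_le_two : ∀ i, {v | i ∈ arg v}.encard ≤ 2
  bi_iff : ∀ a b, G.bi.Adj a b ↔ a ≠ b ∧ ∃ i, i ∈ arg a ∧ i ∈ arg b
  f : ∀ v, (∀ w, Ω w) → (∀ i, Θ i) → Ω v
  f_congr : ∀ v (ω ω' : ∀ w, Ω w) (θ θ' : ∀ i, Θ i),
    (∀ w, G.dir w v → ω w = ω' w) → (∀ i ∈ arg v, θ i = θ' i) → f v ω θ = f v ω' θ'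
  measurable_f : ∀ v, Measurable fun q : (∀ w, Ω w) × (∀ i, Θ i) => f v q.1 q.2

namespace SemiMarkovianModel

attribute [instance] fintypeU measurableSpaceΘ isProbabilityMeasure_law

variable {V : Type u} {G : SMG V} {Ω : V → Type u} [∀ v, MeasurableSpace (Ω v)]

section Solution

variable [Finite V] [∀ v, Nonempty (Ω v)]

open Classical in
/-- The values of the observed variables determined by the values `θ` of the background
variables, computed recursively along the acyclic graph. -/
noncomputable def solution (M : SemiMarkovianModel G Ω) (θ : ∀ i, M.Θ i) : ∀ v, Ω v :=
  G.wellFounded_dir.fix fun v ih =>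
    M.f v (fun w => if h : G.dir w v then ih w h else Classical.arbitrary (Ω w)) θ

theorem solution_eq (M : SemiMarkovianModel G Ω) (θ : ∀ i, M.Θ i) (v : V) :
    M.solution θ v = M.f v (M.solution θ) θ := by
  rw [solution, WellFounded.fix_eq]
  refine M.f_congr v _ _ _ _ (fun w hw => ?_) (fun _ _ => rfl)
  simp [hw]

theorem solution_unique (M : SemiMarkovianModel G Ω) (θ : ∀ i, M.Θ i) (ω : ∀ v, Ω v)
    (h : ∀ v, ω v = M.f v ω θ) : ω = M.solution θ := by
  funext v
  induction v using G.wellFounded_dir.induction with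
  | _ v ih =>
    rw [h v, M.solution_eq θ v]
    exact M.f_congr v _ _ _ _ ih (fun _ _ => rfl)

theorem measurable_solution (M : SemiMarkovianModel G Ω) : Measurable M.solution := by
  classical
  refine measurable_pi_iff.2 fun v => ?_
  induction v using G.wellFounded_dir.induction with
  | _ v ih =>
    have key : (fun θ => M.solution θ v) = fun θ => M.f v
        (fun w => if G.dir w v then M.solution θ w else Classical.arbitrary (Ω w)) θ := by
      funext θ
      rw [M.solution_eq θ v]
      refine M.f_congr v _ _ _ _ (fun w hw => ?_) (fun _ _ => rfl)
      simp [hw]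
    rw [key]
    refine (M.measurable_f v).comp (Measurable.prodMk (measurable_pi_iff.2 fun w => ?_)
      measurable_id)
    change Measurable fun θ => if G.dir w v then M.solution θ w else Classical.arbitrary (Ω w)
    by_cases hw : G.dir w v
    · simpa only [if_pos hw] using ih w hw
    · simpa only [if_neg hw] using measurable_const

/-- The joint distribution `P(v)` of the observed variables. -/
noncomputable def observed (M : SemiMarkovianModel G Ω) : Measure (∀ v, Ω v) :=
  (Measure.pi M.law).map M.solution

end Solution

open Classical in
/-- The submodel `M_x`: for each `v` in `X` the function `f v` is replaced by the constant
`x v`. Its causal diagram is `G` without the edges into `X`. Only the coordinates of `x` in `X`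
matter. -/
noncomputable def intervene (M : SemiMarkovianModel G Ω) (X : Set V) (x : ∀ v, Ω v) :
    SemiMarkovianModel (G.removeIn X) Ω where
  U := M.U
  Θ := M.Θ
  law := M.law
  arg v := {i | i ∈ M.arg v ∧ v ∉ X}
  arg_le_two i := (Set.encard_le_encard fun _ h => h.1).trans (M.arg_le_two i)
  bi_iff a b := by
    change (G.bi.Adj a b ∧ a ∉ X ∧ b ∉ X) ↔ _
    rw [M.bi_iff]
    constructor
    · rintro ⟨⟨hne, i, ha, hb⟩, haX, hbX⟩
      exact ⟨hne, i, ⟨ha, haX⟩, ⟨hb, hbX⟩⟩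
    · rintro ⟨hne, i, ⟨ha, haX⟩, ⟨hb, hbX⟩⟩
      exact ⟨⟨hne, i, ha, hb⟩, haX, hbX⟩
  f v ω θ := if v ∈ X then x v else M.f v ω θ
  f_congr v ω ω' θ θ' hω hθ := by
    by_cases hv : v ∈ X
    · simp [hv]
    · simp only [hv, if_false]
      exact M.f_congr v _ _ _ _ (fun w hw => hω w ⟨hw, hv⟩) (fun i hi => hθ i ⟨hi, hv⟩)
  measurable_f v := by
    by_cases hv : v ∈ X
    · simp [hv]
    · simpa [hv] using M.measurable_f v

/-- The causal effect `P_x(y)`: the probability in the submodel `M_x` that the variables in `Y`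
take the values prescribed by `y`. Only the coordinates of `x` in `X` and of `y` in `Y` matter. -/
noncomputable def effect [Finite V] [∀ v, Nonempty (Ω v)] (M : SemiMarkovianModel G Ω)
    (X Y : Set V) (x y : ∀ v, Ω v) : ℝ≥0∞ :=
  (M.intervene X x).observed {ω | ∀ v ∈ Y, ω v = y v}

end SemiMarkovianModel

section Identification

variable {V : Type u} [Finite V]

/-- The restriction of an assignment of values to the variables in `S`. -/
def restrictTo {Ω : V → Type u} (S : Set V) (ω : ∀ v, Ω v) : ∀ v : S, Ω v := fun v => ω v

/-- The marginal distribution `P(S)`. -/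
noncomputable def marginal {Ω : V → Type u} [∀ v, MeasurableSpace (Ω v)] (S : Set V)
    (P : Measure (∀ v, Ω v)) : Measure (∀ v : S, Ω v) :=
  P.map (restrictTo S)

/-- The functional `F` computes the causal effect `P_x(y)` from `P(V)` (for all values `x`, `y`) in
every causal model with causal diagram `G` whose observed distribution is positive. -/
def Identifies (G : SMG V) (Ω : V → Type u) [∀ v, MeasurableSpace (Ω v)] [∀ v, Nonempty (Ω v)]
    (X Y : Set V) (F : Measure (∀ v, Ω v) → (∀ v, Ω v) → (∀ v, Ω v) → ℝ≥0∞) : Prop :=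
  ∀ M : SemiMarkovianModel G Ω, (∀ ω, M.observed {ω} ≠ 0) →
    ∀ x y, F M.observed x y = M.effect X Y x y

/-- The causal effect of `X` on `Y` is identifiable from `P` in `G`. -/
def Identifiable (G : SMG V) (Ω : V → Type u) [∀ v, MeasurableSpace (Ω v)]
    [∀ v, Nonempty (Ω v)] (X Y : Set V) : Prop :=
  ∃ F, Identifies G Ω X Y F

end Identification

/-!
Put `C = Co(V \ R)` in `G_{\bar W}`, so that `T` is the complement of `C`. As `C` is a union of
connected components of `G_{\bar W}`, every edge of `G` between `C` and `T` has an arrowhead at `W`.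
If `W ∈ T`, no vertex of `C` has a parent in `T`, and forgetting `T` is harmless. If `W ∈ C`, no
vertex of `T` has a parent in `C`, and only `W` has parents in `T` or shares background variables
with `T`. So the values on `T` are a function of background variables that no vertex of `C` other
than `W` uses; handing these variables over to `W` gives a model on `G[C]`, and it has the same
effects because intervening inside `C` does not change the values on `T`.

Conversely, a model on `G[C]` extends to one on `G` by independent noise with full support on `T`.
The extended observed distribution is the product of the old one with this fixed noise, so it is
positive if the old one is and can be computed from it.
-/

namespace SMG

variable {V : Type u} {G : SMG V} {A S : Set V} {W a b : V}

theorem subset_Co (G : SMG V) (A : Set V) : A ⊆ G.Co A :=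
  fun v hv => ⟨v, hv, .refl v⟩

theorem subset_De (G : SMG V) (A : Set V) : A ⊆ G.De A :=
  fun v hv => ⟨v, hv, .refl⟩

theorem Co_Co (G : SMG V) (A : Set V) : G.Co (G.Co A) = G.Co A :=
  Set.Subset.antisymm (fun _ ⟨_, ⟨r, hr, hrs⟩, hsv⟩ => ⟨r, hr, hrs.trans hsv⟩) (G.subset_Co _)

theorem compl_diff_Co_compl (G : SMG V) (A : Set V) : (A \ G.Co Aᶜ)ᶜ = G.Co Aᶜ := by
  rw [Set.compl_sdiff, Set.union_eq_left.2 (G.subset_Co Aᶜ)]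

theorem subset_De_of_An_eq_univ {X Y : Set V} (hG : G.An Y = Set.univ) (hX : X.Nonempty)
    (hY : Y.Subsingleton) : Y ⊆ G.De X := by
  obtain ⟨x, hx⟩ := hX
  obtain ⟨y, hy, hxy⟩ : x ∈ G.An Y := hG ▸ Set.mem_univ x
  exact fun y' hy' => hY hy hy' ▸ ⟨x, hx, hxy⟩

theorem skeleton_adj_of_dir (h : G.dir a b) : G.skeleton.Adj a b :=
  (SimpleGraph.fromRel_adj _ _ _).2 ⟨fun hab => G.acyclic b (.single (hab ▸ h)), .inl (.inl h)⟩

theorem skeleton_adj_of_bi (h : G.bi.Adj a b) : G.skeleton.Adj a b :=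
  (SimpleGraph.fromRel_adj _ _ _).2 ⟨h.ne, .inl (.inr h)⟩

theorem mem_iff_mem_of_skeleton_adj (hS : G.Co S = S) (h : G.skeleton.Adj a b) :
    a ∈ S ↔ b ∈ S :=
  ⟨fun ha => hS ▸ ⟨a, ha, h.reachable⟩, fun hb => hS ▸ ⟨b, hb, h.symm.reachable⟩⟩

theorem mem_iff_mem_of_dir (hS : (G.removeIn {W}).Co S = S) (h : G.dir a b) (hb : b ≠ W) :
    a ∈ S ↔ b ∈ S :=
  mem_iff_mem_of_skeleton_adj hS (skeleton_adj_of_dir (G := G.removeIn {W}) ⟨h, hb⟩)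

theorem mem_iff_mem_of_bi (hS : (G.removeIn {W}).Co S = S) (h : G.bi.Adj a b) (ha : a ≠ W)
    (hb : b ≠ W) : a ∈ S ↔ b ∈ S :=
  mem_iff_mem_of_skeleton_adj hS (skeleton_adj_of_bi (G := G.removeIn {W}) ⟨h, ha, hb⟩)

theorem notMem_of_dir_of_notMem (hS : (G.removeIn {W}).Co S = S) (hW : W ∈ S) (h : G.dir a b)
    (hb : b ∉ S) : a ∉ S :=
  fun ha => hb ((mem_iff_mem_of_dir hS h fun hbW => hb (hbW ▸ hW)).1 ha)

theorem eq_of_dir_of_notMem_of_mem (hS : (G.removeIn {W}).Co S = S) (h : G.dir a b) (ha : a ∉ S)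
    (hb : b ∈ S) : b = W := by
  by_contra hbW
  exact ha ((mem_iff_mem_of_dir hS h hbW).2 hb)

end SMG

section Glue

variable {V : Type u} {Ω : V → Type u} {S : Set V}

open Classical in
/-- The assignment that agrees with `ω` on `S` and with `η` off `S`. -/
noncomputable def glue (S : Set V) (ω : ∀ v : S, Ω v) (η : ∀ v, Ω v) : ∀ v, Ω v :=
  fun v => if h : v ∈ S then ω ⟨v, h⟩ else η v

theorem glue_of_mem (ω : ∀ v : S, Ω v) (η : ∀ v, Ω v) {v : V} (h : v ∈ S) :
    glue S ω η v = ω ⟨v, h⟩ :=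
  dif_pos h

theorem glue_of_notMem (ω : ∀ v : S, Ω v) (η : ∀ v, Ω v) {v : V} (h : v ∉ S) :
    glue S ω η v = η v :=
  dif_neg h

theorem restrictTo_glue (ω : ∀ v : S, Ω v) (η : ∀ v, Ω v) : restrictTo S (glue S ω η) = ω :=
  funext fun v => glue_of_mem ω η v.2

theorem glue_restrictTo_self (S : Set V) (ω : ∀ v, Ω v) : glue S (restrictTo S ω) ω = ω := by
  funext v
  by_cases hv : v ∈ S
  · rw [glue_of_mem _ _ hv, restrictTo]
  · rw [glue_of_notMem _ _ hv]

variable [∀ v, MeasurableSpace (Ω v)]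

theorem measurable_restrictTo : Measurable (restrictTo (Ω := Ω) S) :=
  Set.measurable_restrict S

theorem measurable_glue :
    Measurable fun q : (∀ v : S, Ω v) × (∀ v, Ω v) => glue S q.1 q.2 := by
  refine measurable_pi_iff.2 fun v => ?_
  by_cases hv : v ∈ S
  · simp only [glue_of_mem _ _ hv]
    exact (measurable_pi_apply (⟨v, hv⟩ : S)).comp measurable_fst
  · simp only [glue_of_notMem _ _ hv]
    exact (measurable_pi_apply v).comp measurable_snd

end Glue

section Marginal

variable {V : Type u} {Ω : V → Type u} [∀ v, MeasurableSpace (Ω v)] {S : Set V}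

/-- The joint distribution of the variables in `S`, distributed according to `P`, and of independent
variables off `S`, distributed according to the marginal of `ν`. -/
noncomputable def independentExtension (P : Measure (∀ v : S, Ω v)) (ν : Measure (∀ v, Ω v)) :
    Measure (∀ v, Ω v) :=
  (P.prod ν).map fun q => glue S q.1 q.2

theorem marginal_independentExtension (P : Measure (∀ v : S, Ω v))
    (ν : Measure (∀ v, Ω v)) [IsProbabilityMeasure ν] :
    marginal S (independentExtension P ν) = P := by
  have h : restrictTo S ∘ (fun q : (∀ v : S, Ω v) × (∀ v, Ω v) => glue S q.1 q.2) = Prod.fst :=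
    funext fun q => restrictTo_glue q.1 q.2
  rw [marginal, independentExtension, Measure.map_map measurable_restrictTo measurable_glue, h]
  exact measurePreserving_fst.map_eq

variable [Finite V] [∀ v, MeasurableSingletonClass (Ω v)]

theorem independentExtension_singleton_ne_zero {P : Measure (∀ v : S, Ω v)}
    {ν : Measure (∀ v, Ω v)} [SFinite ν] (hP : ∀ ω, P {ω} ≠ 0) (hν : ∀ ω, ν {ω} ≠ 0)
    (ω : ∀ v, Ω v) : independentExtension P ν {ω} ≠ 0 := by
  have hsub : ({restrictTo S ω} : Set (∀ v : S, Ω v)) ×ˢ {ω} ⊆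
      (fun q => glue S q.1 q.2) ⁻¹' {ω} := by
    rw [Set.singleton_prod_singleton, Set.singleton_subset_iff]
    exact glue_restrictTo_self S ω
  rw [independentExtension, Measure.map_apply measurable_glue (measurableSet_singleton ω)]
  refine fun h => mul_ne_zero (hP (restrictTo S ω)) (hν ω) ?_
  rw [← Measure.prod_prod]
  exact measure_mono_null hsub h

theorem marginal_singleton_ne_zero [∀ v, Nonempty (Ω v)] (S : Set V) {P : Measure (∀ v, Ω v)}
    (hP : ∀ ω, P {ω} ≠ 0) (ω : ∀ v : S, Ω v) : marginal S P {ω} ≠ 0 := by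
  obtain ⟨ω, rfl⟩ : ∃ ω', restrictTo S ω' = ω :=
    ⟨glue S ω fun v => Classical.arbitrary (Ω v), restrictTo_glue _ _⟩
  rw [marginal, Measure.map_apply measurable_restrictTo (measurableSet_singleton _)]
  exact fun h => hP ω (measure_mono_null (t := restrictTo S ⁻¹' _) (by rintro _ rfl; rfl) h)

end Marginal

theorem exists_isProbabilityMeasure_singleton_ne_zero (α : Type*) [MeasurableSpace α]
    [Countable α] [Nonempty α] [MeasurableSingletonClass α] :
    ∃ μ : Measure α, IsProbabilityMeasure μ ∧ ∀ a, μ {a} ≠ 0 := by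
  refine ⟨(Measure.count : Measure α).toFinite, inferInstance, fun a h => ?_⟩
  have hcount := absolutelyContinuous_toFinite (Measure.count : Measure α) h
  rw [Measure.count_singleton] at hcount
  exact one_ne_zero hcount

namespace SemiMarkovianModel

variable {V : Type u} {G : SMG V} {Ω : V → Type u} [∀ v, MeasurableSpace (Ω v)] {S : Set V}

section Marginal

variable [Finite V] [∀ v, Nonempty (Ω v)]

instance isProbabilityMeasure_observed (M : SemiMarkovianModel G Ω) :
    IsProbabilityMeasure M.observed :=
  Measure.isProbabilityMeasure_map M.measurable_solution.aemeasurable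

theorem solution_intervene_of_mem (M : SemiMarkovianModel G Ω) {X : Set V} (x : ∀ v, Ω v)
    (θ : ∀ i, M.Θ i) {v : V} (hv : v ∈ X) : (M.intervene X x).solution θ v = x v :=
  ((M.intervene X x).solution_eq θ v).trans (if_pos hv)

theorem solution_intervene_of_notMem (M : SemiMarkovianModel G Ω) {X : Set V} (x : ∀ v, Ω v)
    (θ : ∀ i, M.Θ i) {v : V} (hv : v ∉ X) :
    (M.intervene X x).solution θ v = M.f v ((M.intervene X x).solution θ) θ :=
  ((M.intervene X x).solution_eq θ v).trans (if_neg hv)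

theorem solution_intervene_unique (M : SemiMarkovianModel G Ω) {X : Set V} {x : ∀ v, Ω v}
    {θ : ∀ i, M.Θ i} {ω : ∀ v, Ω v} (hX : ∀ v ∈ X, ω v = x v)
    (hf : ∀ v ∉ X, ω v = M.f v ω θ) : ω = (M.intervene X x).solution θ := by
  refine (M.intervene X x).solution_unique θ ω fun v => ?_
  by_cases hv : v ∈ X
  · exact (hX v hv).trans (if_pos hv).symm
  · exact (hf v hv).trans (if_neg hv).symm

theorem marginal_observed_eq_of_measurePreserving {M : SemiMarkovianModel G Ω} {G' : SMG S}
    {M' : SemiMarkovianModel G' (fun v : S => Ω v)} {φ : (∀ i, M.Θ i) → ∀ i, M'.Θ i}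
    (hφ : MeasurePreserving φ (Measure.pi M.law) (Measure.pi M'.law))
    (h : ∀ θ, restrictTo S (M.solution θ) = M'.solution (φ θ)) :
    marginal S M.observed = M'.observed := by
  rw [marginal, observed, observed, Measure.map_map measurable_restrictTo M.measurable_solution,
    ← hφ.map_eq, Measure.map_map M'.measurable_solution hφ.measurable]
  exact congrArg (Measure.map · (Measure.pi M.law)) (funext h)

theorem effect_eq_marginal [∀ v, MeasurableSingletonClass (Ω v)] (M : SemiMarkovianModel G Ω)
    (X : Set V) {Y : Set V} (hY : Y ⊆ S) (x y : ∀ v, Ω v) :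
    M.effect X Y x y = marginal S (M.intervene X x).observed
      {ω | ∀ v ∈ (Subtype.val ⁻¹' Y : Set S), ω v = restrictTo S y v} := by
  have hcylinder : MeasurableSet {ω : ∀ v : S, Ω v |
      ∀ v ∈ (Subtype.val ⁻¹' Y : Set S), ω v = restrictTo S y v} :=
    MeasurableSet.pi (Set.to_countable _) fun v _ => measurableSet_singleton (restrictTo S y v)
  rw [effect, marginal, Measure.map_apply measurable_restrictTo hcylinder]
  exact congrArg _ (Set.ext fun ω => ⟨fun h v hv => h v hv, fun h v hv => h ⟨v, hY hv⟩ hv⟩)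

end Marginal

section Project

variable {W : V}

/-- The background variables of `s` in the model from which the variables off `S` have been
removed: `W` takes over all background variables of the removed variables. -/
def projectArg (M : SemiMarkovianModel G Ω) (S : Set V) (W : V) (s : S) : Set M.U :=
  {i | i ∈ M.arg s ∨ (s : V) = W ∧ ∃ t ∉ S, i ∈ M.arg t}

theorem eq_of_mem_arg_of_notMem (M : SemiMarkovianModel G Ω) (hS : (G.removeIn {W}).Co S = S)
    (hW : W ∈ S) {i : M.U} {s t : V} (hs : s ∈ S) (ht : t ∉ S) (his : i ∈ M.arg s)
    (hit : i ∈ M.arg t) : s = W := by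
  have hst : G.bi.Adj s t := (M.bi_iff s t).2 ⟨fun h => ht (h ▸ hs), i, his, hit⟩
  by_contra hsW
  exact ht ((SMG.mem_iff_mem_of_bi hS hst hsW fun htW => ht (htW ▸ hW)).1 hs)

theorem eq_of_mem_projectArg_of_notMem (M : SemiMarkovianModel G Ω)
    (hS : (G.removeIn {W}).Co S = S) (hW : W ∈ S) {i : M.U} {s : S} {t : V} (ht : t ∉ S)
    (his : i ∈ M.projectArg S W s) (hit : i ∈ M.arg t) : (s : V) = W :=
  his.elim (fun h => M.eq_of_mem_arg_of_notMem hS hW s.2 ht h hit) And.left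

theorem encard_projectArg_le_two (M : SemiMarkovianModel G Ω) (hS : (G.removeIn {W}).Co S = S)
    (i : M.U) : {s | i ∈ M.projectArg S W s}.encard ≤ 2 := by
  by_cases hi : W ∈ S ∧ ∃ t ∉ S, i ∈ M.arg t
  · obtain ⟨hW, t, ht, hit⟩ := hi
    refine (Set.encard_le_one_iff.2 fun a b ha hb => Subtype.ext ?_).trans one_le_two
    exact (M.eq_of_mem_projectArg_of_notMem hS hW ht ha hit).trans
      (M.eq_of_mem_projectArg_of_notMem hS hW ht hb hit).symm
  · rw [← Subtype.val_injective.encard_image]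
    refine (Set.encard_le_encard (Set.image_subset_iff.2 fun s hs => ?_)).trans (M.arg_le_two i)
    exact hs.resolve_right fun h => hi ⟨h.1 ▸ s.2, h.2⟩

theorem bi_adj_iff_projectArg (M : SemiMarkovianModel G Ω) (hS : (G.removeIn {W}).Co S = S)
    (a b : S) : G.bi.Adj a b ↔ a ≠ b ∧ ∃ i, i ∈ M.projectArg S W a ∧ i ∈ M.projectArg S W b := by
  rw [M.bi_iff, Ne, Subtype.coe_inj]
  refine and_congr_right fun hab => ⟨fun ⟨i, ha, hb⟩ => ⟨i, .inl ha, .inl hb⟩, ?_⟩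
  rintro ⟨i, ha, hb⟩
  have not_both_W (haW : (a : V) = W) (hbW : (b : V) = W) : False :=
    hab (Subtype.ext (haW.trans hbW.symm))
  rcases ha with ha | ⟨haW, t, ht, hit⟩
  · rcases hb with hb | ⟨hbW, t, ht, hit⟩
    · exact ⟨i, ha, hb⟩
    · exact (not_both_W (M.eq_of_mem_arg_of_notMem hS (hbW ▸ b.2) a.2 ht ha hit) hbW).elim
  · exact (not_both_W haW (M.eq_of_mem_projectArg_of_notMem hS (haW ▸ a.2) ht hb hit)).elim

variable [Finite V] [∀ v, Nonempty (Ω v)]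

theorem solution_congr_of_notMem (M : SemiMarkovianModel G Ω) (hS : (G.removeIn {W}).Co S = S)
    (hW : W ∈ S) {θ θ' : ∀ i, M.Θ i} (h : ∀ t ∉ S, ∀ i ∈ M.arg t, θ i = θ' i) {t : V}
    (ht : t ∉ S) : M.solution θ t = M.solution θ' t := by
  induction t using G.wellFounded_dir.induction with
  | _ t ih =>
    rw [M.solution_eq, M.solution_eq θ']
    exact M.f_congr _ _ _ _ _
      (fun w hw => ih w hw (SMG.notMem_of_dir_of_notMem hS hW hw ht)) (h t ht)

theorem solution_intervene_eq_solution_of_notMem (M : SemiMarkovianModel G Ω)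
    (hS : (G.removeIn {W}).Co S = S) (hW : W ∈ S) {X : Set V} (hX : X ⊆ S) (x : ∀ v, Ω v)
    (θ : ∀ i, M.Θ i) {t : V} (ht : t ∉ S) : (M.intervene X x).solution θ t = M.solution θ t := by
  induction t using G.wellFounded_dir.induction with
  | _ t ih =>
    refine (M.solution_intervene_of_notMem x θ fun h => ht (hX h)).trans
      (.trans ?_ (M.solution_eq θ t).symm)
    exact M.f_congr _ _ _ _ _
      (fun w hw => ih w hw (SMG.notMem_of_dir_of_notMem hS hW hw ht)) fun _ _ => rfl

/-- The model of the variables in `S` only. A function that has arguments off `S` (necessarily that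
of `W`) computes their values from the background variables that it takes over from them. -/
noncomputable def project (M : SemiMarkovianModel G Ω) (hS : (G.removeIn {W}).Co S = S) :
    SemiMarkovianModel (G.induce S) (fun v : S => Ω v) where
  U := M.U
  Θ := M.Θ
  law := M.law
  arg := M.projectArg S W
  arg_le_two := M.encard_projectArg_le_two hS
  bi_iff := M.bi_adj_iff_projectArg hS
  f s ω θ := M.f s (glue S ω (M.solution θ)) θ
  f_congr s ω ω' θ θ' hω hθ := by
    refine M.f_congr s _ _ _ _ (fun w hw => ?_) fun i hi => hθ i (.inl hi)
    by_cases hwS : w ∈ S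
    · rw [glue_of_mem _ _ hwS, glue_of_mem _ _ hwS]
      exact hω ⟨w, hwS⟩ hw
    · have hsW : (s : V) = W := SMG.eq_of_dir_of_notMem_of_mem hS hw hwS s.2
      rw [glue_of_notMem _ _ hwS, glue_of_notMem _ _ hwS]
      exact M.solution_congr_of_notMem hS (hsW ▸ s.2)
        (fun t ht i hi => hθ i (.inr ⟨hsW, t, ht, hi⟩)) hwS
  measurable_f s := (M.measurable_f s).comp <| Measurable.prodMk
    (measurable_glue.comp (measurable_fst.prodMk (M.measurable_solution.comp measurable_snd)))
    measurable_snd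

theorem restrictTo_solution_eq_solution_project (M : SemiMarkovianModel G Ω)
    (hS : (G.removeIn {W}).Co S = S) (θ : ∀ i, M.Θ i) :
    restrictTo S (M.solution θ) = (M.project hS).solution θ := by
  refine (M.project hS).solution_unique θ _ fun s => ?_
  change M.solution θ s = M.f s (glue S (restrictTo S (M.solution θ)) (M.solution θ)) θ
  rw [glue_restrictTo_self, ← M.solution_eq]

theorem restrictTo_solution_intervene_eq_solution_intervene_project (M : SemiMarkovianModel G Ω)
    (hS : (G.removeIn {W}).Co S = S) {X : Set V} (hX : X ⊆ S) (x : ∀ v, Ω v) (θ : ∀ i, M.Θ i) :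
    restrictTo S ((M.intervene X x).solution θ)
      = ((M.project hS).intervene (Subtype.val ⁻¹' X) (restrictTo S x)).solution θ := by
  refine (M.project hS).solution_intervene_unique (fun s hs => M.solution_intervene_of_mem x θ hs)
    fun s hs => (M.solution_intervene_of_notMem x θ hs).trans ?_
  refine M.f_congr s _ _ θ θ (fun w hw => ?_) fun _ _ => rfl
  by_cases hwS : w ∈ S
  · exact (glue_of_mem (restrictTo S _) _ hwS).symm
  · have hsW : (s : V) = W := SMG.eq_of_dir_of_notMem_of_mem hS hw hwS s.2
    exact (M.solution_intervene_eq_solution_of_notMem hS (hsW ▸ s.2) hX x θ hwS).trans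
      (glue_of_notMem _ _ hwS).symm

theorem observed_project (M : SemiMarkovianModel G Ω) (hS : (G.removeIn {W}).Co S = S) :
    (M.project hS).observed = marginal S M.observed :=
  (marginal_observed_eq_of_measurePreserving (.id _)
    (M.restrictTo_solution_eq_solution_project hS)).symm

theorem effect_project [∀ v, MeasurableSingletonClass (Ω v)] (M : SemiMarkovianModel G Ω)
    (hS : (G.removeIn {W}).Co S = S) {X Y : Set V} (hX : X ⊆ S) (hY : Y ⊆ S) (x y : ∀ v, Ω v) :
    (M.project hS).effect (Subtype.val ⁻¹' X) (Subtype.val ⁻¹' Y) (restrictTo S x)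
      (restrictTo S y) = M.effect X Y x y := by
  rw [M.effect_eq_marginal X hY, marginal_observed_eq_of_measurePreserving (.id _)
    (M.restrictTo_solution_intervene_eq_solution_intervene_project hS hX x)]
  rfl

end Project

section Extend

/-- The background variables of `v` in the extension of `M` to a model with diagram `G`: those of
`M`, a private one for each vertex, and one for each bidirected edge, shared by its endpoints. -/
def extendArg (M : SemiMarkovianModel (G.induce S) (fun v : S => Ω v)) (v : V) :
    Set (M.U ⊕ V ⊕ G.bi.edgeSet) :=
  {i | match i with
    | .inl j => ∃ h : v ∈ S, j ∈ M.arg ⟨v, h⟩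
    | .inr (.inl w) => v = w
    | .inr (.inr e) => v ∈ e.1}

theorem encard_extendArg_le_two (M : SemiMarkovianModel (G.induce S) (fun v : S => Ω v))
    (i : M.U ⊕ V ⊕ G.bi.edgeSet) : {v | i ∈ M.extendArg v}.encard ≤ 2 := by
  rcases i with j | w | ⟨e, he⟩
  · refine (Set.encard_le_encard ?_).trans
      ((Subtype.val_injective.encard_image _).trans_le (M.arg_le_two j))
    exact fun v ⟨hv, hj⟩ => ⟨⟨v, hv⟩, hj, rfl⟩
  · exact (Set.encard_singleton w).trans_le one_le_two
  · induction e with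
    | _ a b =>
      have hsub : {v | Sum.inr (Sum.inr ⟨s(a, b), he⟩) ∈ M.extendArg v} ⊆ {a, b} :=
        fun v hv => Sym2.mem_iff.1 hv
      refine (Set.encard_le_encard hsub).trans ((Set.encard_insert_le _ _).trans_eq ?_)
      rw [Set.encard_singleton, one_add_one_eq_two]

theorem bi_adj_iff_extendArg (M : SemiMarkovianModel (G.induce S) (fun v : S => Ω v)) (a b : V) :
    G.bi.Adj a b ↔ a ≠ b ∧ ∃ i, i ∈ M.extendArg a ∧ i ∈ M.extendArg b := by
  constructor
  · exact fun h => ⟨h.ne, .inr (.inr ⟨s(a, b), h⟩), Sym2.mem_mk_left a b, Sym2.mem_mk_right a b⟩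
  · rintro ⟨hab, j | w | ⟨e, he⟩, ha, hb⟩
    · obtain ⟨haS, ha⟩ := ha
      obtain ⟨hbS, hb⟩ := hb
      exact (M.bi_iff ⟨a, haS⟩ ⟨b, hbS⟩).2 ⟨fun h => hab (congrArg Subtype.val h), j, ha, hb⟩
    · exact absurd (Eq.trans ha (Eq.symm hb)) hab
    · obtain rfl : e = s(a, b) := (Sym2.mem_and_mem_iff hab).1 ⟨ha, hb⟩
      exact he

/-- The values of the background variables of the extension of `M` to a model with diagram `G`. The
variables of the bidirected edges carry no information: they only produce the required diagram. -/
def ExtendΘ (M : SemiMarkovianModel (G.induce S) (fun v : S => Ω v)) :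
    M.U ⊕ V ⊕ G.bi.edgeSet → Type u
  | .inl j => M.Θ j
  | .inr (.inl v) => Ω v
  | .inr (.inr _) => PUnit

instance measurableSpaceExtendΘ (M : SemiMarkovianModel (G.induce S) (fun v : S => Ω v)) :
    ∀ i, MeasurableSpace (M.ExtendΘ i)
  | .inl j => M.measurableSpaceΘ j
  | .inr (.inl v) => inferInstanceAs (MeasurableSpace (Ω v))
  | .inr (.inr _) => inferInstanceAs (MeasurableSpace PUnit)

/-- The laws of the background variables of the extension of `M`, with noise `ν`. -/
noncomputable def extendLaw (M : SemiMarkovianModel (G.induce S) (fun v : S => Ω v))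
    (ν : ∀ v, Measure (Ω v)) : ∀ i, Measure (M.ExtendΘ i)
  | .inl j => M.law j
  | .inr (.inl v) => ν v
  | .inr (.inr _) => Measure.dirac PUnit.unit

instance isProbabilityMeasure_extendLaw (M : SemiMarkovianModel (G.induce S) (fun v : S => Ω v))
    (ν : ∀ v, Measure (Ω v)) [∀ v, IsProbabilityMeasure (ν v)] :
    ∀ i, IsProbabilityMeasure (M.extendLaw ν i)
  | .inl j => M.isProbabilityMeasure_law j
  | .inr (.inl v) => inferInstanceAs (IsProbabilityMeasure (ν v))
  | .inr (.inr _) => Measure.dirac.isProbabilityMeasure (α := PUnit)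

/-- The values of the background variables of the extension of `M`, split into those of `M` and
the noise; the trivial variables of the bidirected edges are dropped. -/
def splitBackground (M : SemiMarkovianModel (G.induce S) (fun v : S => Ω v))
    (θ : ∀ i, M.ExtendΘ i) : (∀ j, M.Θ j) × ∀ v, Ω v :=
  (fun j => θ (.inl j), fun v => θ (.inr (.inl v)))

variable [Fintype V] [Fintype G.bi.edgeSet]
  (M : SemiMarkovianModel (G.induce S) (fun v : S => Ω v))
  (ν : ∀ v, Measure (Ω v)) [∀ v, IsProbabilityMeasure (ν v)]

theorem measurePreserving_splitBackground :
    MeasurePreserving M.splitBackground (Measure.pi (M.extendLaw ν))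
      ((Measure.pi M.law).prod (Measure.pi ν)) :=
  ((MeasurePreserving.id (Measure.pi M.law)).prod (measurePreserving_fst.comp
    (measurePreserving_sumPiEquivProdPi fun i => M.extendLaw ν (.inr i)))).comp
    (measurePreserving_sumPiEquivProdPi (M.extendLaw ν))

theorem measurePreserving_fst_splitBackground :
    MeasurePreserving (fun θ => (M.splitBackground θ).1) (Measure.pi (M.extendLaw ν))
      (Measure.pi M.law) :=
  measurePreserving_fst.comp (M.measurePreserving_splitBackground ν)

/-- The extension of a model with diagram `G[S]` to one with diagram `G`, in which each variable
`v` off `S` is equal to a private background variable with law `ν v`. -/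
noncomputable def extend : SemiMarkovianModel G Ω where
  U := M.U ⊕ V ⊕ G.bi.edgeSet
  Θ := M.ExtendΘ
  law := M.extendLaw ν
  arg := M.extendArg
  arg_le_two := M.encard_extendArg_le_two
  bi_iff := M.bi_adj_iff_extendArg
  f v ω θ := glue S (fun s => M.f s (restrictTo S ω) (M.splitBackground θ).1)
    (M.splitBackground θ).2 v
  f_congr v ω ω' θ θ' hω hθ := by
    by_cases hv : v ∈ S
    · rw [glue_of_mem _ _ hv, glue_of_mem _ _ hv]
      exact M.f_congr _ _ _ _ _ (fun w hw => hω w hw) fun j hj => hθ (.inl j) ⟨hv, hj⟩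
    · rw [glue_of_notMem _ _ hv, glue_of_notMem _ _ hv]
      exact hθ (.inr (.inl v)) rfl
  measurable_f v := by
    have hsplit : Measurable fun q : (∀ w, Ω w) × (∀ i, M.ExtendΘ i) => M.splitBackground q.2 :=
      (M.measurePreserving_splitBackground ν).measurable.comp measurable_snd
    have hf : Measurable fun q : (∀ w, Ω w) × (∀ i, M.ExtendΘ i) =>
        fun s : S => M.f s (restrictTo S q.1) (M.splitBackground q.2).1 :=
      measurable_pi_iff.2 fun s => (M.measurable_f s).comp
        ((measurable_restrictTo.comp measurable_fst).prodMk (measurable_fst.comp hsplit))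
    exact (measurable_pi_apply v).comp
      (measurable_glue.comp (hf.prodMk (measurable_snd.comp hsplit)))

theorem extend_f_of_mem {v : V} (hv : v ∈ S) (ω : ∀ v, Ω v) (θ : ∀ i, M.ExtendΘ i) :
    (M.extend ν).f v ω θ = M.f ⟨v, hv⟩ (restrictTo S ω) (M.splitBackground θ).1 :=
  glue_of_mem (fun s => M.f s (restrictTo S ω) (M.splitBackground θ).1)
    (M.splitBackground θ).2 hv

theorem extend_f_of_notMem {v : V} (hv : v ∉ S) (ω : ∀ v, Ω v) (θ : ∀ i, M.ExtendΘ i) :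
    (M.extend ν).f v ω θ = (M.splitBackground θ).2 v :=
  glue_of_notMem (fun s => M.f s (restrictTo S ω) (M.splitBackground θ).1)
    (M.splitBackground θ).2 hv

variable [∀ v, Nonempty (Ω v)]

theorem solution_extend (θ : ∀ i, M.ExtendΘ i) :
    (M.extend ν).solution θ
      = glue S (M.solution (M.splitBackground θ).1) (M.splitBackground θ).2 := by
  refine ((M.extend ν).solution_unique θ _ fun v => ?_).symm
  by_cases hv : v ∈ S
  · rw [extend_f_of_mem _ _ hv, restrictTo_glue, glue_of_mem _ _ hv]
    exact M.solution_eq _ _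
  · rw [extend_f_of_notMem _ _ hv, glue_of_notMem _ _ hv]

theorem restrictTo_solution_intervene_extend (X : Set V) (x : ∀ v, Ω v) (θ : ∀ i, M.ExtendΘ i) :
    restrictTo S (((M.extend ν).intervene X x).solution θ)
      = (M.intervene (Subtype.val ⁻¹' X) (restrictTo S x)).solution (M.splitBackground θ).1 :=
  M.solution_intervene_unique (fun _ hs => (M.extend ν).solution_intervene_of_mem x θ hs)
    fun s hs => ((M.extend ν).solution_intervene_of_notMem x θ hs).trans
      (M.extend_f_of_mem ν s.2 _ θ)

theorem observed_extend :
    (M.extend ν).observed = independentExtension M.observed (Measure.pi ν) := by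
  have hsplit := M.measurePreserving_splitBackground ν
  have hsolution := M.measurable_solution.prodMap (measurable_id (α := ∀ v, Ω v))
  calc (M.extend ν).observed
      = (Measure.pi (M.extendLaw ν)).map
          ((fun q => glue S q.1 q.2) ∘ Prod.map M.solution id ∘ M.splitBackground) :=
        congrArg (Measure.map · (Measure.pi (M.extendLaw ν))) (funext (M.solution_extend ν))
    _ = (((Measure.pi M.law).prod (Measure.pi ν)).map (Prod.map M.solution id)).map
          fun q => glue S q.1 q.2 := by
        rw [← hsplit.map_eq, Measure.map_map hsolution hsplit.measurable,
          Measure.map_map measurable_glue (hsolution.comp hsplit.measurable)]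
    _ = independentExtension M.observed (Measure.pi ν) := by
        rw [← Measure.map_prod_map _ _ M.measurable_solution measurable_id, Measure.map_id]
        rfl

variable [∀ v, MeasurableSingletonClass (Ω v)]

theorem effect_extend (X : Set V) {Y : Set V} (hY : Y ⊆ S) (x y : ∀ v, Ω v) :
    (M.extend ν).effect X Y x y = M.effect (Subtype.val ⁻¹' X) (Subtype.val ⁻¹' Y)
      (restrictTo S x) (restrictTo S y) := by
  rw [effect_eq_marginal _ X hY, marginal_observed_eq_of_measurePreserving
    (M := (M.extend ν).intervene X x)
    (M' := M.intervene (Subtype.val ⁻¹' X) (restrictTo S x))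
    (M.measurePreserving_fst_splitBackground ν)
    (M.restrictTo_solution_intervene_extend ν X x)]
  rfl

theorem observed_extend_singleton_ne_zero (hM : ∀ ω, M.observed {ω} ≠ 0)
    (hν : ∀ v a, ν v {a} ≠ 0) (ω : ∀ v, Ω v) : (M.extend ν).observed {ω} ≠ 0 := by
  rw [observed_extend]
  refine independentExtension_singleton_ne_zero hM (fun η => ?_) ω
  rw [Measure.pi_singleton]
  exact Finset.prod_ne_zero_iff.2 fun v _ => hν v (η v)

end Extend

end SemiMarkovianModel

section Identification

variable {V : Type u} [Finite V] {Ω : V → Type u} [∀ v, MeasurableSpace (Ω v)]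
  [∀ v, Nonempty (Ω v)] [∀ v, MeasurableSingletonClass (Ω v)] {G : SMG V} {X Y S : Set V} {W : V}

theorem Identifies.of_induce (hS : (G.removeIn {W}).Co S = S) (hX : X ⊆ S) (hY : Y ⊆ S)
    {F : Measure (∀ v : S, Ω v) → (∀ v : S, Ω v) → (∀ v : S, Ω v) → ℝ≥0∞}
    (hF : Identifies (G.induce S) (fun v : S => Ω v) (Subtype.val ⁻¹' X) (Subtype.val ⁻¹' Y) F) :
    Identifies G Ω X Y (fun P x y => F (marginal S P) (restrictTo S x) (restrictTo S y)) := by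
  intro M hM x y
  dsimp only
  rw [← M.effect_project hS hX hY, ← M.observed_project hS]
  refine hF (M.project hS) ?_ _ _
  rw [M.observed_project hS]
  exact marginal_singleton_ne_zero S hM

variable [∀ v, Countable (Ω v)]

theorem Identifies.exists_independentExtension
    {F : Measure (∀ v, Ω v) → (∀ v, Ω v) → (∀ v, Ω v) → ℝ≥0∞}
    (hF : Identifies G Ω X Y F) (hY : Y ⊆ S) :
    ∃ ν : Measure (∀ v, Ω v), IsProbabilityMeasure ν ∧
      Identifies (G.induce S) (fun v : S => Ω v) (Subtype.val ⁻¹' X) (Subtype.val ⁻¹' Y)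
        fun P x y => F (independentExtension P ν)
          (glue S x fun _ => Classical.arbitrary _) (glue S y fun _ => Classical.arbitrary _) := by
  cases nonempty_fintype V
  cases nonempty_fintype G.bi.edgeSet
  choose ν hν hpos using fun v => exists_isProbabilityMeasure_singleton_ne_zero (Ω v)
  refine ⟨Measure.pi ν, inferInstance, fun M hM x y => ?_⟩
  dsimp only
  rw [← M.observed_extend, hF (M.extend ν) (M.observed_extend_singleton_ne_zero ν hM hpos),
    M.effect_extend ν X hY, restrictTo_glue, restrictTo_glue]

theorem identifies_induce_iff (hS : (G.removeIn {W}).Co S = S) (hX : X ⊆ S) (hY : Y ⊆ S)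
    (F : Measure (∀ v : S, Ω v) → (∀ v : S, Ω v) → (∀ v : S, Ω v) → ℝ≥0∞) :
    Identifies (G.induce S) (fun v : S => Ω v) (Subtype.val ⁻¹' X) (Subtype.val ⁻¹' Y) F ↔
      Identifies G Ω X Y
        (fun P x y => F (marginal S P) (restrictTo S x) (restrictTo S y)) := by
  refine ⟨Identifies.of_induce hS hX hY, fun hF M hM x y => ?_⟩
  obtain ⟨ν, _, h⟩ := hF.exists_independentExtension hY
  simpa only [marginal_independentExtension, restrictTo_glue] using h M hM x y

theorem identifiable_induce_iff (hS : (G.removeIn {W}).Co S = S) (hX : X ⊆ S) (hY : Y ⊆ S) :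
    Identifiable (G.induce S) (fun v : S => Ω v) (Subtype.val ⁻¹' X) (Subtype.val ⁻¹' Y) ↔
      Identifiable G Ω X Y := by
  refine ⟨fun ⟨_, hF⟩ => ⟨_, hF.of_induce hS hX hY⟩, fun ⟨_, hF⟩ => ?_⟩
  obtain ⟨ν, -, h⟩ := hF.exists_independentExtension hY
  exact ⟨_, h⟩

end Identification

theorem mainTheorem5_general {V : Type u} [Finite V] (Ω : V → Type u)
    [∀ v, MeasurableSpace (Ω v)] [∀ v, Nonempty (Ω v)] [∀ v, Countable (Ω v)]
    [∀ v, MeasurableSingletonClass (Ω v)] (G : SMG V) (X Y : Set V) (W : V) (R T S : Set V)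
    (hR : Disjoint R (G.De X)) (hT : T = R \ (G.removeIn {W}).Co Rᶜ) (hS : S = Tᶜ) :
    Disjoint T X ∧
    (Y ⊆ G.De X → Disjoint T Y) ∧
    (Disjoint T Y →
      (∀ M : SemiMarkovianModel G Ω,
        ∃ M' : SemiMarkovianModel (G.induce S) (fun v : S => Ω v),
          M'.observed = marginal S M.observed ∧
          ∀ x y : ∀ v, Ω v,
            M'.effect (Subtype.val ⁻¹' X) (Subtype.val ⁻¹' Y) (restrictTo S x) (restrictTo S y)
              = M.effect X Y x y) ∧
      (∀ F : Measure (∀ v : S, Ω v) → (∀ v : S, Ω v) → (∀ v : S, Ω v) → ℝ≥0∞,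
        Identifies (G.induce S) (fun v : S => Ω v) (Subtype.val ⁻¹' X) (Subtype.val ⁻¹' Y) F ↔
        Identifies G Ω X Y
          (fun P x y => F (marginal S P) (restrictTo S x) (restrictTo S y))) ∧
      (Identifiable (G.induce S) (fun v : S => Ω v) (Subtype.val ⁻¹' X) (Subtype.val ⁻¹' Y) ↔
        Identifiable G Ω X Y)) := by
  have hTDe : Disjoint T (G.De X) := hT ▸ hR.mono_left Set.sdiff_subset
  have hTX : Disjoint T X := hTDe.mono_right (G.subset_De X)
  have hXS : X ⊆ S := hS ▸ hTX.subset_compl_left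
  have hSCo : (G.removeIn {W}).Co S = S := by
    rw [hS, hT, SMG.compl_diff_Co_compl, SMG.Co_Co]
  refine ⟨hTX, hTDe.mono_right, fun hTY => ?_⟩
  have hYS : Y ⊆ S := hS ▸ hTY.subset_compl_left
  exact ⟨fun M => ⟨M.project hSCo, M.observed_project hSCo, M.effect_project hSCo hXS hYS⟩,
    identifies_induce_iff hSCo hXS hYS, identifiable_induce_iff hSCo hXS hYS⟩

theorem mainTheorem5 {V : Type u} [Finite V] (Ω : V → Type u) [∀ v, MeasurableSpace (Ω v)]
    [∀ v, Nonempty (Ω v)] [∀ v, Countable (Ω v)] [∀ v, MeasurableSingletonClass (Ω v)]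
    (G : SMG V) (X Y : Set V) (hXY : Disjoint X Y) (hG : G.An Y = Set.univ)
    (W : V) (R T S : Set V)
    (hR : R = (G.removeIn X).An {W} \ G.De X)
    (hT : T = R \ (G.removeIn {W}).Co Rᶜ)
    (hS : S = Tᶜ) :
    Disjoint T X ∧
    (Y ⊆ G.De X → Disjoint T Y) ∧
    (X.Nonempty → Y.Subsingleton → Disjoint T Y) ∧
    (Disjoint T Y →
      (∀ M : SemiMarkovianModel G Ω,
        ∃ M' : SemiMarkovianModel (G.induce S) (fun v : S => Ω v),
          M'.observed = marginal S M.observed ∧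
          ∀ x y : ∀ v, Ω v,
            M'.effect (Subtype.val ⁻¹' X) (Subtype.val ⁻¹' Y) (restrictTo S x) (restrictTo S y)
              = M.effect X Y x y) ∧
      (∀ F : Measure (∀ v : S, Ω v) → (∀ v : S, Ω v) → (∀ v : S, Ω v) → ℝ≥0∞,
        Identifies (G.induce S) (fun v : S => Ω v) (Subtype.val ⁻¹' X) (Subtype.val ⁻¹' Y) F ↔
        Identifies G Ω X Y
          (fun P x y => F (marginal S P) (restrictTo S x) (restrictTo S y))) ∧
      (Identifiable (G.induce S) (fun v : S => Ω v) (Subtype.val ⁻¹' X) (Subtype.val ⁻¹' Y) ↔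
        Identifiable G Ω X Y)) := by
  obtain ⟨hTX, hTY, hremove⟩ :=
    mainTheorem5_general Ω G X Y W R T S (hR ▸ Set.disjoint_sdiff_left) hT hS
  exact ⟨hTX, hTY, fun hX hY => hTY (SMG.subset_De_of_An_eq_univ hG hX hY), hremove⟩
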